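/- Let $k$ be an arbitrary field of characteristic $p>0$, let $n\ge 1$, write $\boldsymbol t=(t_1,\dots,t_n)$, and let $f=\sum_{\boldsymbol i\in\mathbb N^n}a(\boldsymbol i)\boldsymbol t^{\boldsymbol i}\in k[[\boldsymbol t]]$ be a power series that is algebraic over $k(\boldsymbol t)$. Let $E(\boldsymbol t,y)\in k[\boldsymbol t,y]$ be a nonzero polynomial with $E(\boldsymbol t,f)=0$ that divides every polynomial $Q\in k[\boldsymbol t,y]$ with $Q(\boldsymbol t,f)=0$; such an $E$ exists and is unique up to a nonzero constant factor. Let $d$ (the degree of $f$) be the degree of $E$ in $y$, let $h$ (the total height of $f$) be the total degree of $E$ in $\boldsymbol t$, and let $(h_1,\dots,h_n)$ (the partial height of $f$) be given by $h_i=\deg_{t_i}E$. Set $$N:=(d+1)\cdot\min\left\{\prod_{i=1}^n(h_i+1)-\prod_{i=1}^n h_i,\ \binom{n+h}{n}-\binom{h}{n}\right\}.$$ Then the diagonal $\Delta(f)(t)=\sum_{i\ge 0}a(i,\dots,i)\,t^i\in k[[t]]$ is annihilated by a linearized polynomial with coefficients in $k(t)$ of $p$-degree at most $N$, that is, there are an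 integer $0\le m\le N$ and $c_0,\dots,c_m\in k(t)$ with $c_m\ne 0$ such that $$c_0\,\Delta(f)+c_1\,\Delta(f)^p+\cdots+c_m\,\Delta(f)^{p^m}=0 .$$ In particular, $\Delta(f)$ is algebraic over $k(t)$ of degree at most $p^N-1$. -/

import Mathlib

open Polynomial
open scoped RatFunc

namespace AlgSeries

noncomputable section

/-- The diagonal `Δ(f)(t) = ∑ᵢ a(i, …, i) tⁱ` of `f = ∑ a(i₁, …, iₙ) t₁^{i₁} ⋯ tₙ^{iₙ}`. -/
def diagonal {n : ℕ} {k : Type*} [Field k] (f : MvPowerSeries (Fin n) k) : PowerSeries k :=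
  PowerSeries.mk fun i => MvPowerSeries.coeff (Finsupp.equivFunOnFinite.symm fun _ => i) f

/-- `E ∈ k[t₁, …, tₙ][y]` is a nonzero polynomial with `E(t, f) = 0` which is minimal for
divisibility among the polynomials that vanish at `f`. -/
def IsMinimalPolynomial {n : ℕ} {k : Type*} [Field k] (f : MvPowerSeries (Fin n) k)
    (E : (MvPolynomial (Fin n) k)[X]) : Prop :=
  E ≠ 0 ∧ aeval f E = 0 ∧ ∀ Q : (MvPolynomial (Fin n) k)[X], aeval f Q = 0 → E ∣ Q

/-- Over a factorial ring, an irreducible polynomial of positive degree vanishing at `f` divides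
every polynomial vanishing at `f`. -/
theorem dvd_of_irreducible_of_aeval_eq_zero {A B : Type*} (K L : Type*) [CommRing A] [IsDomain A]
    [UniqueFactorizationMonoid A] [CommRing B] [Field K] [Algebra A K] [IsFractionRing A K]
    [Field L] [Algebra B L] [Algebra A B]
    (hinj : Function.Injective ((algebraMap B L).comp (algebraMap A B))) {f : B} {E : A[X]}
    (hE : Irreducible E) (hdeg : E.natDegree ≠ 0) (hEf : aeval f E = 0)
    (Q : A[X]) (hQ : aeval f Q = 0) : E ∣ Q := by
  have hprim : E.IsPrimitive := hE.isPrimitive hdeg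
  have hev : ∀ R : A[X], aeval f R = 0 →
      eval₂ (IsFractionRing.lift hinj : K →+* L) (algebraMap B L f)
        (R.map (algebraMap A K)) = 0 := by
    intro R hR
    have hφ : (IsFractionRing.lift hinj : K →+* L).comp (algebraMap A K) =
        (algebraMap B L).comp (algebraMap A B) :=
      RingHom.ext fun x => IsFractionRing.lift_algebraMap hinj x
    rw [eval₂_map, hφ, ← hom_eval₂, ← aeval_def, hR, map_zero]
  have hirr : Irreducible (E.map (algebraMap A K)) :=
    hprim.irreducible_iff_irreducible_map_fraction_map.1 hE
  apply hprim.dvd_of_fraction_map_dvd_fraction_map (K := K)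
  by_contra hnd
  obtain ⟨u, v, huv⟩ := (hirr.coprime_iff_not_dvd).2 hnd
  have h1 := congrArg (eval₂ (IsFractionRing.lift hinj : K →+* L) (algebraMap B L f)) huv
  rw [eval₂_add, eval₂_mul, eval₂_mul, hev E hEf, hev Q hQ, mul_zero, mul_zero, add_zero,
    eval₂_one] at h1
  exact zero_ne_one h1

/-- An element algebraic over a factorial ring `A` (in a domain containing `A`) is a root of a
nonzero polynomial over `A` that divides every polynomial over `A` vanishing at it. -/
theorem exists_minimal_of_isAlgebraic {A B : Type*} [CommRing A] [IsDomain A]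
    [UniqueFactorizationMonoid A] [CommRing B] [IsDomain B] [Algebra A B]
    (hinj : Function.Injective (algebraMap A B)) {f : B} (hf : IsAlgebraic A f) :
    ∃ E : A[X], E ≠ 0 ∧ aeval f E = 0 ∧ ∀ Q : A[X], aeval f Q = 0 → E ∣ Q := by
  obtain ⟨E₀, hE₀, hE₀f⟩ := hf
  have hker : (RingHom.ker (aeval (R := A) f)).IsPrime := RingHom.ker_isPrime _
  have hne : RingHom.ker (aeval (R := A) f) ≠ ⊥ := fun h =>
    hE₀ (Ideal.mem_bot.1 (h ▸ RingHom.mem_ker.2 hE₀f))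
  obtain ⟨E, hEf, hE⟩ := hker.exists_mem_prime_of_ne_bot hne
  rw [RingHom.mem_ker] at hEf
  have hdeg : E.natDegree ≠ 0 := by
    intro h0
    rw [eq_C_of_natDegree_eq_zero h0, aeval_C] at hEf
    apply hE.ne_zero
    rw [eq_C_of_natDegree_eq_zero h0, hinj (hEf.trans (map_zero _).symm), C_0]
  exact ⟨E, hE.ne_zero, hEf, dvd_of_irreducible_of_aeval_eq_zero (FractionRing A) (FractionRing B)
    (by
      rw [RingHom.coe_comp]
      exact (IsFractionRing.injective B (FractionRing B)).comp hinj) hE.irreducible hdeg hEf⟩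

/-- Every algebraic power series has a minimal polynomial in `k[t₁, …, tₙ][y]`. -/
theorem exists_isMinimalPolynomial {n : ℕ} {k : Type*} [Field k] {f : MvPowerSeries (Fin n) k}
    (hf : IsAlgebraic (MvPolynomial (Fin n) k) f) : ∃ E, IsMinimalPolynomial f E := by
  have : IsDomain (MvPowerSeries (Fin n) k) := NoZeroDivisors.to_isDomain _
  refine exists_minimal_of_isAlgebraic (fun a b hab => ?_) hf
  simpa [MvPowerSeries.algebraMap_apply'] using hab

/-- Two minimal polynomials of `f` agree up to a nonzero constant of `k`. -/
theorem IsMinimalPolynomial.exists_eq_mul {n : ℕ} {k : Type*} [Field k]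
    {f : MvPowerSeries (Fin n) k} {E E' : (MvPolynomial (Fin n) k)[X]}
    (hE : IsMinimalPolynomial f E) (hE' : IsMinimalPolynomial f E') :
    ∃ c : k, c ≠ 0 ∧ E' = C (MvPolynomial.C c) * E := by
  obtain ⟨u, hu⟩ := associated_of_dvd_dvd (hE.2.2 E' hE'.2.1) (hE'.2.2 E hE.2.1)
  obtain ⟨r, hr, hru⟩ := Polynomial.isUnit_iff.1 u.isUnit
  rw [MvPolynomial.isUnit_iff_eq_C_of_isReduced] at hr
  obtain ⟨c, hc, rfl⟩ := hr
  exact ⟨c, hc.ne_zero, by rw [← hu, ← hru, mul_comm]⟩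

open Classical in
/-- A minimal polynomial `E(t, y)` of `f` (unique up to a nonzero constant factor); the value is
`0` if `f` is not algebraic. -/
def minimalPolynomial {n : ℕ} {k : Type*} [Field k] (f : MvPowerSeries (Fin n) k) :
    (MvPolynomial (Fin n) k)[X] :=
  if h : ∃ E, IsMinimalPolynomial f E then h.choose else 0

theorem isMinimalPolynomial_minimalPolynomial {n : ℕ} {k : Type*} [Field k]
    {f : MvPowerSeries (Fin n) k} (hf : IsAlgebraic (MvPolynomial (Fin n) k) f) :
    IsMinimalPolynomial f (minimalPolynomial f) := by
  have h := exists_isMinimalPolynomial hf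
  rw [minimalPolynomial, dif_pos h]
  exact h.choose_spec

/-- The degree of `f`: the degree in `y` of `E(t, y)`. -/
def degree {n : ℕ} {k : Type*} [Field k] (f : MvPowerSeries (Fin n) k) : ℕ :=
  (minimalPolynomial f).natDegree

/-- The total height of `f`: the total degree in `t = (t₁, …, tₙ)` of `E(t, y)`. -/
def totalHeight {n : ℕ} {k : Type*} [Field k] (f : MvPowerSeries (Fin n) k) : ℕ :=
  (minimalPolynomial f).support.sup fun j => ((minimalPolynomial f).coeff j).totalDegree

/-- The partial height of `f`: the tuple whose `i`-th entry is the degree in `tᵢ` of `E(t, y)`. -/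
def partialHeight {n : ℕ} {k : Type*} [Field k] (f : MvPowerSeries (Fin n) k) (i : Fin n) : ℕ :=
  (minimalPolynomial f).support.sup fun j => ((minimalPolynomial f).coeff j).degreeOf i

/-- `N = (d + 1) · min {∏ (hᵢ + 1) - ∏ hᵢ, C(n + h, n) - C(h, n)}`. Both differences are
nonnegative, so the subtractions of natural numbers are genuine. -/
def bound {n : ℕ} (d h : ℕ) (hs : Fin n → ℕ) : ℕ :=
  (d + 1) * min ((∏ i, (hs i + 1)) - ∏ i, hs i) ((n + h).choose n - h.choose n)

/-- `P = c₀ X + c₁ X^p + ⋯ + c_m X^{p^m}` with `c_m ≠ 0`: a linearized polynomial of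
`p`-degree `m`. -/
def IsLinearized {K : Type*} [Field K] (p m : ℕ) (P : K[X]) : Prop :=
  ∃ c : ℕ → K, c m ≠ 0 ∧ P = ∑ i ∈ Finset.range (m + 1), C (c i) * X ^ (p ^ i)

end

end AlgSeries

/-! Power series embed in the field of Hahn series with exponents in `ℤⁿ` ordered lexicographically,
where one can divide by `E_y(t, f)` and still take diagonals. This element is nonzero over any `k`,
perfect or not (`IsMinimalPolynomial.aeval_derivative_ne_zero`).

Consider the quotients `tⁱ fʲ / E_y(t, f)` with `j ≤ d` and `i` in a box or simplex containing the
`t`-exponents of `E`. Cartier's formula (`eval_mul_derivative_pow_eq_sum`) writes each as a sum of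
terms `c tʳ zᵖ` with entries of `r` below `p` and `z` again such a quotient: the exponents of `tⁱ
E^(p-1)` lie in the `p`-fold dilate of the region, and division by `p` leads back into it. The
diagonal of `c tʳ zᵖ` vanishes unless `r` is constant, and is then a monomial times the `p`-th power
of the diagonal of `z`. The scalars `c` stay outside the power, so no `p`-th roots in `k` are
needed. As `t₁⋯tₙ` leaves the diagonal as a factor `t`, only those `i` with a zero entry count;
their number times `d + 1` is at most `N`.

Hence at most `N` Laurent series are `k(t)`-combinations of their own `p`-th powers, and `Δ(f)` lies
in their span because `f = f E_y / E_y`. The spans of their `p^m`-th powers increase with `m` and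
have dimension at most `N`, so `Δ(f), Δ(f)^p, …, Δ(f)^(p^N)` are linearly dependent
(`exists_isLinearized_of_mem_span`). -/

open scoped Pointwise

/-! ### Hahn series in characteristic `p`: coefficients of `p`-th powers. -/

namespace HahnSeries

/-- The supports of the `m`-th powers of the series supported in a partially well-ordered set are
contained in a common partially well-ordered set. -/
theorem exists_isPWO_support_pow_subset {Γ R : Type*} [AddCommMonoid Γ] [PartialOrder Γ]
    [IsOrderedCancelAddMonoid Γ] [Semiring R] {S : Set Γ} (hS : S.IsPWO) (m : ℕ) :
    ∃ T : Set Γ, T.IsPWO ∧ ∀ y : HahnSeries Γ R, y.support ⊆ S → (y ^ m).support ⊆ T := by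
  induction m with
  | zero =>
    refine ⟨{0}, Set.isPWO_singleton 0, fun y _ a ha => ?_⟩
    by_contra h
    rw [mem_support, pow_zero, coeff_one, if_neg (by exact h)] at ha
    exact ha rfl
  | succ m ih =>
    obtain ⟨T, hT, h⟩ := ih
    refine ⟨T + S, hT.add hS, fun y hy => ?_⟩
    rw [pow_succ]
    exact support_mul_subset.trans (Set.add_subset_add (h y hy) hy)

instance charP {Γ R : Type*} [AddCommMonoid Γ] [PartialOrder Γ]
    [IsOrderedCancelAddMonoid Γ] [CommRing R] (p : ℕ) [CharP R p] : CharP (HahnSeries Γ R) p :=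
  charP_of_injective_ringHom (C_injective (Γ := Γ) (R := R)) p

/-- Frobenius is additive on finite sums, so `z` is split into a finite part on `F` and a remainder
whose `p`-th power does not reach `g`. The set `F₀` serves to force chosen indices into `F`. -/
theorem exists_coeff_pow_char_eq_sum {Γ R : Type*} [AddCommMonoid Γ] [PartialOrder Γ]
    [IsOrderedCancelAddMonoid Γ] [CommRing R] (p : ℕ) [Fact p.Prime] [CharP R p]
    (z : HahnSeries Γ R) (g : Γ) (F₀ : Finset Γ) :
    ∃ F : Finset Γ, F₀ ⊆ F ∧
      (z ^ p).coeff g = ∑ s ∈ F, (single (p • s) (z.coeff s ^ p)).coeff g := by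
  classical
  -- The remainder `z₂` depends on `F`, so `T` has to bound the `(p-1)`-th powers of all series
  -- supported in the support of `z` before `F` is chosen. Then `F` catches every last factor of `z₂
  -- ^ (p-1) * z₂` that could contribute to `g`.
  obtain ⟨T, hT, hsub⟩ := exists_isPWO_support_pow_subset (R := R) z.isPWO_support (p - 1)
  set F : Finset Γ := F₀ ∪ (Finset.antidiagonal hT z.isPWO_support g).image Prod.snd with hF
  refine ⟨F, Finset.subset_union_left, ?_⟩
  set z₁ : HahnSeries Γ R := ∑ s ∈ F, single s (z.coeff s) with hz₁
  have hc : ∀ s, z₁.coeff s = if s ∈ F then z.coeff s else 0 := by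
    intro s
    rw [hz₁, coeff_sum]
    simp [coeff_single]
  set z₂ := z - z₁ with hz₂
  have hc₂ : ∀ s, z₂.coeff s = if s ∈ F then 0 else z.coeff s := by
    intro s
    rw [hz₂, coeff_sub, hc]
    split_ifs <;> simp
  have hs₂ : z₂.support ⊆ z.support := by
    intro s hs
    rw [mem_support, hc₂] at hs
    rw [mem_support]
    split_ifs at hs
    · exact absurd rfl hs
    · exact hs
  have h₂ : (z₂ ^ p).coeff g = 0 := by
    by_contra hne
    have hp : p = (p - 1) + 1 := (Nat.succ_pred_prime Fact.out).symm
    rw [← Ne, ← mem_support, hp, pow_succ] at hne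
    obtain ⟨a, ha, b, hb, hab⟩ := Set.mem_add.1 (support_mul_subset hne)
    have hbF : b ∈ F := by
      rw [hF, Finset.mem_union]
      refine Or.inr (Finset.mem_image.2 ⟨(a, b), ?_, rfl⟩)
      exact Finset.mem_antidiagonal.2 ⟨hsub _ hs₂ ha, hs₂ hb, hab⟩
    rw [mem_support, hc₂, if_pos hbF] at hb
    exact hb rfl
  have hz : z = z₁ + z₂ := by rw [hz₂]; abel
  calc (z ^ p).coeff g = (z₁ ^ p).coeff g := by
        rw [hz, add_pow_char, coeff_add, h₂, add_zero]
    _ = _ := by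
        rw [hz₁, sum_pow_char, coeff_sum]
        simp only [single_pow]

theorem coeff_pow_char_nsmul {Γ R : Type*} [AddCommMonoid Γ] [PartialOrder Γ]
    [IsOrderedCancelAddMonoid Γ] [IsAddTorsionFree Γ] [CommRing R] (p : ℕ) [hp : Fact p.Prime]
    [CharP R p] (z : HahnSeries Γ R) (s : Γ) : (z ^ p).coeff (p • s) = z.coeff s ^ p := by
  classical
  obtain ⟨F, hF, h⟩ := exists_coeff_pow_char_eq_sum p z (p • s) {s}
  rw [h, Finset.sum_eq_single s]
  · rw [coeff_single_same]
  · intro b _ hb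
    rw [coeff_single_of_ne]
    exact fun he => hb (nsmul_right_injective hp.out.ne_zero he.symm)
  · exact fun hs => absurd (hF (Finset.mem_singleton_self s)) hs

theorem coeff_pow_char_of_forall_ne {Γ R : Type*} [AddCommMonoid Γ] [PartialOrder Γ]
    [IsOrderedCancelAddMonoid Γ] [CommRing R] (p : ℕ) [Fact p.Prime] [CharP R p]
    (z : HahnSeries Γ R) {g : Γ} (hg : ∀ s, p • s ≠ g) : (z ^ p).coeff g = 0 := by
  obtain ⟨F, -, h⟩ := exists_coeff_pow_char_eq_sum p z g ∅
  rw [h]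
  exact Finset.sum_eq_zero fun s _ => coeff_single_of_ne (hg s).symm

/-! ### Power series as Hahn series. -/

/-- The embedding of multivariate power series into Hahn series given by a monotone injective
map of exponents; unlike in `embDomainRingHom`, the map need not reflect the order. -/
noncomputable def mapExponents {σ Γ R : Type*} [Finite σ] [PartialOrder Γ]
    [Zero R] (e : (σ →₀ ℕ) → Γ) (hm : Monotone e) (f : MvPowerSeries σ R) : HahnSeries Γ R where
  coeff := Function.extend e f 0
  isPWO_support' :=
    ((Set.isPWO_of_wellQuasiOrderedLE (Set.univ : Set (σ →₀ ℕ))).image_of_monotone hm).mono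
      fun _ ha => by
        by_contra h
        exact ha (Function.extend_apply' _ _ _ fun ⟨m, hm⟩ => h ⟨m, trivial, hm⟩)

theorem coeff_mapExponents {σ Γ R : Type*} [Finite σ] [PartialOrder Γ] [Semiring R]
    {e : (σ →₀ ℕ) → Γ} (he : Function.Injective e) (hm : Monotone e) (f : MvPowerSeries σ R)
    (m : σ →₀ ℕ) : (mapExponents e hm f).coeff (e m) = MvPowerSeries.coeff m f :=
  he.extend_apply _ _ _

theorem coeff_mapExponents_of_forall_ne {σ Γ R : Type*} [Finite σ] [PartialOrder Γ]
    [Zero R] {e : (σ →₀ ℕ) → Γ} (hm : Monotone e) (f : MvPowerSeries σ R)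
    {g : Γ} (hg : ∀ m, e m ≠ g) : (mapExponents e hm f).coeff g = 0 :=
  Function.extend_apply' _ _ _ fun ⟨m, h⟩ => hg m h

theorem mapExponents_mul {σ Γ R : Type*} [Finite σ] [AddCommMonoid Γ] [PartialOrder Γ]
    [IsOrderedCancelAddMonoid Γ] [Semiring R] (e : (σ →₀ ℕ) →+ Γ) (he : Function.Injective e)
    (hm : Monotone e) (f g : MvPowerSeries σ R) :
    mapExponents e hm (f * g) = mapExponents e hm f * mapExponents e hm g := by
  classical
  ext a
  rw [coeff_mul]
  have hr : ∀ (f : MvPowerSeries σ R) {b : Γ}, (mapExponents e hm f).coeff b ≠ 0 →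
      ∃ m, e m = b := fun f b hb => by
    by_contra! h
    exact hb (coeff_mapExponents_of_forall_ne hm f h)
  by_cases ha : ∃ m, e m = a
  · obtain ⟨m, rfl⟩ := ha
    rw [coeff_mapExponents he, MvPowerSeries.coeff_mul]
    refine Finset.sum_bij_ne_zero (fun x _ _ => (e x.1, e x.2)) ?_ ?_ ?_ ?_
    · intro x hx hne
      refine Finset.mem_antidiagonal.2 ⟨?_, ?_, ?_⟩
      · rw [mem_support, coeff_mapExponents he]
        exact left_ne_zero_of_mul hne
      · rw [mem_support, coeff_mapExponents he]
        exact right_ne_zero_of_mul hne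
      · rw [← map_add, Finset.HasAntidiagonal.mem_antidiagonal.1 hx]
    · intro x _ _ y _ _ h
      rw [Prod.mk.injEq] at h
      exact Prod.ext (he h.1) (he h.2)
    · rintro ⟨b, c⟩ hx hne
      obtain ⟨i, rfl⟩ := hr f (left_ne_zero_of_mul hne)
      obtain ⟨j, rfl⟩ := hr g (right_ne_zero_of_mul hne)
      have hij : e i + e j = e m := (Finset.mem_antidiagonal.1 hx).2.2
      rw [← map_add] at hij
      rw [coeff_mapExponents he, coeff_mapExponents he] at hne
      exact ⟨(i, j), Finset.HasAntidiagonal.mem_antidiagonal.2 (he hij), hne, rfl⟩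
    · intro x _ _
      rw [coeff_mapExponents he, coeff_mapExponents he]
  · rw [coeff_mapExponents_of_forall_ne hm _ fun m h => ha ⟨m, h⟩]
    refine (Finset.sum_eq_zero fun x hx => ?_).symm
    by_contra hne
    obtain ⟨i, hi⟩ := hr f (left_ne_zero_of_mul hne)
    obtain ⟨j, hj⟩ := hr g (right_ne_zero_of_mul hne)
    exact ha ⟨i + j, by rw [map_add, hi, hj]; exact (Finset.mem_antidiagonal.1 hx).2.2⟩

theorem mapExponents_monomial {σ Γ R : Type*} [Finite σ] [PartialOrder Γ] [Semiring R]
    {e : (σ →₀ ℕ) → Γ} (he : Function.Injective e) (hm : Monotone e) (m : σ →₀ ℕ) (r : R) :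
    mapExponents e hm (MvPowerSeries.monomial m r) = single (e m) r := by
  classical
  ext a
  by_cases ha : ∃ i, e i = a
  · obtain ⟨i, rfl⟩ := ha
    rw [coeff_mapExponents he, MvPowerSeries.coeff_monomial, coeff_single]
    simp only [he.eq_iff]
  · rw [coeff_mapExponents_of_forall_ne hm _ fun m h => ha ⟨m, h⟩, coeff_single_of_ne]
    exact fun h => ha ⟨m, h.symm⟩

/-- `mapExponents` as a ring homomorphism. -/
noncomputable def ofMvPowerSeries {σ Γ R : Type*} [Finite σ] [AddCommMonoid Γ] [PartialOrder Γ]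
    [IsOrderedCancelAddMonoid Γ] [Semiring R] (e : (σ →₀ ℕ) →+ Γ) (he : Function.Injective e)
    (hm : Monotone e) : MvPowerSeries σ R →+* HahnSeries Γ R where
  toFun := mapExponents e hm
  map_one' := by
    rw [← MvPowerSeries.monomial_zero_one, mapExponents_monomial he, map_zero]
    rfl
  map_mul' := mapExponents_mul e he hm
  map_zero' := by
    rw [← map_zero (MvPowerSeries.monomial (R := R) (0 : σ →₀ ℕ)), mapExponents_monomial he,
      map_zero]
  map_add' f g := by
    ext a
    rw [coeff_add]
    by_cases ha : ∃ i, e i = a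
    · obtain ⟨i, rfl⟩ := ha
      simp only [coeff_mapExponents he, map_add]
    · simp only [coeff_mapExponents_of_forall_ne hm _ fun m h => ha ⟨m, h⟩, add_zero]

theorem ofMvPowerSeries_monomial {σ Γ R : Type*} [Finite σ] [AddCommMonoid Γ] [PartialOrder Γ]
    [IsOrderedCancelAddMonoid Γ] [Semiring R] (e : (σ →₀ ℕ) →+ Γ) (he : Function.Injective e)
    (hm : Monotone e) (m : σ →₀ ℕ) (r : R) :
    ofMvPowerSeries e he hm (MvPowerSeries.monomial m r) = single (e m) r :=
  mapExponents_monomial he hm m r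

theorem coeff_ofMvPowerSeries {σ Γ R : Type*} [Finite σ] [AddCommMonoid Γ] [PartialOrder Γ]
    [IsOrderedCancelAddMonoid Γ] [Semiring R] (e : (σ →₀ ℕ) →+ Γ) (he : Function.Injective e)
    (hm : Monotone e) (f : MvPowerSeries σ R) (m : σ →₀ ℕ) :
    (ofMvPowerSeries e he hm f).coeff (e m) = MvPowerSeries.coeff m f :=
  coeff_mapExponents he hm f m

theorem coeff_ofMvPowerSeries_of_forall_ne {σ Γ R : Type*} [Finite σ] [AddCommMonoid Γ]
    [PartialOrder Γ] [IsOrderedCancelAddMonoid Γ] [Semiring R] (e : (σ →₀ ℕ) →+ Γ)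
    (he : Function.Injective e) (hm : Monotone e) (f : MvPowerSeries σ R) {g : Γ}
    (hg : ∀ m, e m ≠ g) : (ofMvPowerSeries e he hm f).coeff g = 0 :=
  coeff_mapExponents_of_forall_ne hm f hg

theorem ofMvPowerSeries_injective {σ Γ R : Type*} [Finite σ] [AddCommMonoid Γ] [PartialOrder Γ]
    [IsOrderedCancelAddMonoid Γ] [Semiring R] (e : (σ →₀ ℕ) →+ Γ) (he : Function.Injective e)
    (hm : Monotone e) : Function.Injective (ofMvPowerSeries (R := R) e he hm) := fun f g h => by
  ext m
  rw [← coeff_ofMvPowerSeries e he hm f, h, coeff_ofMvPowerSeries]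

end HahnSeries

namespace AlgSeries

/-! ### Lexicographic exponents and the diagonal of a Hahn series. -/

/-- Exponent vectors with integer entries, ordered lexicographically. -/
abbrev LexExponent (n : ℕ) : Type := Lex (Fin n → ℤ)

/-- The inclusion of the exponents of power series into the lexicographically ordered group. -/
def exponentHom (n : ℕ) : (Fin n →₀ ℕ) →+ LexExponent n where
  toFun m := toLex fun l => (m l : ℤ)
  map_zero' := rfl
  map_add' a b := funext fun l => Nat.cast_add (a l) (b l)

theorem exponentHom_apply {n : ℕ} (m : Fin n →₀ ℕ) (l : Fin n) : exponentHom n m l = m l := rfl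

theorem exponentHom_injective (n : ℕ) : Function.Injective (exponentHom n) := fun a b h => by
  ext l
  exact Int.ofNat_inj.1 (congrFun h l)

theorem exponentHom_monotone (n : ℕ) : Monotone (exponentHom n) := fun _ _ h =>
  Pi.toLex_monotone fun l => Int.ofNat_le.2 (h l)

/-- The diagonal inclusion of `ℤ`. -/
def diagExponent (n : ℕ) : ℤ →+ LexExponent n where
  toFun a := toLex fun _ => a
  map_zero' := rfl
  map_add' _ _ := rfl

theorem diagExponent_apply {n : ℕ} (a : ℤ) (l : Fin n) : diagExponent n a l = a := rfl

theorem diagExponent_strictMono (n : ℕ) [NeZero n] : StrictMono (diagExponent n) := fun _ _ h =>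
  Pi.toLex_strictMono <| Pi.lt_def.2 ⟨fun _ => h.le, 0, h⟩

noncomputable section

/-- The embedding of power series into the field of Hahn series with lexicographically ordered
exponents. -/
def toHahn (n : ℕ) (k : Type*) [Field k] :
    MvPowerSeries (Fin n) k →+* HahnSeries (LexExponent n) k :=
  HahnSeries.ofMvPowerSeries (exponentHom n) (exponentHom_injective n) (exponentHom_monotone n)

theorem toHahn_injective (n : ℕ) (k : Type*) [Field k] : Function.Injective (toHahn n k) :=
  HahnSeries.ofMvPowerSeries_injective _ _ _

theorem toHahn_monomial {n : ℕ} {k : Type*} [Field k] (m : Fin n →₀ ℕ) (c : k) :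
    toHahn n k (MvPowerSeries.monomial m c) = HahnSeries.single (exponentHom n m) c :=
  HahnSeries.ofMvPowerSeries_monomial _ _ _ _ _

/-- The diagonal of a Hahn series with exponents in `ℤⁿ`, as a Laurent series. -/
def hahnDiagonal {n : ℕ} [NeZero n] {k : Type*} [Field k] :
    HahnSeries (LexExponent n) k →+ LaurentSeries k where
  toFun x :=
    { coeff a := x.coeff (diagExponent n a)
      isPWO_support' := by
        intro u
        obtain ⟨i, j, hij, h⟩ := x.isPWO_support fun i => ⟨diagExponent n (u i), (u i).2⟩
        exact ⟨i, j, hij, (diagExponent_strictMono n).le_iff_le.1 h⟩ }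
  map_zero' := rfl
  map_add' _ _ := rfl

theorem coeff_hahnDiagonal {n : ℕ} [NeZero n] {k : Type*} [Field k]
    (x : HahnSeries (LexExponent n) k) (a : ℤ) :
    (hahnDiagonal x).coeff a = x.coeff (diagExponent n a) := rfl

theorem hahnDiagonal_toHahn {n : ℕ} [NeZero n] {k : Type*} [Field k]
    (f : MvPowerSeries (Fin n) k) :
    hahnDiagonal (toHahn n k f) = (diagonal f : LaurentSeries k) := by
  ext a
  rw [coeff_hahnDiagonal, PowerSeries.coeff_coe]
  split_ifs with ha
  · refine HahnSeries.coeff_ofMvPowerSeries_of_forall_ne _ _ _ _ fun m h => ?_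
    have h0 := congrFun h 0
    rw [exponentHom_apply, diagExponent_apply] at h0
    lia
  · obtain ⟨b, rfl⟩ := Int.eq_ofNat_of_zero_le (not_lt.1 ha)
    rw [diagonal, PowerSeries.coeff_mk, Int.natAbs_natCast]
    exact HahnSeries.coeff_ofMvPowerSeries (exponentHom n) (exponentHom_injective n)
      (exponentHom_monotone n) f (Finsupp.equivFunOnFinite.symm fun _ => b)

theorem hahnDiagonal_single_mul {n : ℕ} [NeZero n] {k : Type*} [Field k] (a : ℤ) (c : k)
    (x : HahnSeries (LexExponent n) k) :
    hahnDiagonal (HahnSeries.single (diagExponent n a) c * x) =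
      HahnSeries.single a c * hahnDiagonal x := by
  ext b
  rw [coeff_hahnDiagonal, HahnSeries.coeff_single_mul, HahnSeries.coeff_single_mul,
    coeff_hahnDiagonal, map_sub]

theorem hahnDiagonal_pow_char {n : ℕ} [NeZero n] {k : Type*} [Field k] (p : ℕ) [Fact p.Prime]
    [CharP k p] (x : HahnSeries (LexExponent n) k) : hahnDiagonal (x ^ p) = hahnDiagonal x ^ p := by
  ext b
  rw [coeff_hahnDiagonal]
  by_cases hb : ∃ a : ℤ, p • a = b
  · obtain ⟨a, rfl⟩ := hb
    rw [map_nsmul, HahnSeries.coeff_pow_char_nsmul, HahnSeries.coeff_pow_char_nsmul,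
      coeff_hahnDiagonal]
  · rw [HahnSeries.coeff_pow_char_of_forall_ne p _ fun a h => hb ⟨a, h⟩,
      HahnSeries.coeff_pow_char_of_forall_ne]
    exact fun s h => hb ⟨s 0, congrFun h 0⟩

/-- The diagonal of `tʳ zᵖ` with all entries of `r` below `p` is a monomial multiple of the
`p`-th power of the diagonal of `z`. -/
theorem exists_hahnDiagonal_single_mul_pow {n : ℕ} [NeZero n] {k : Type*} [Field k] (p : ℕ)
    [Fact p.Prime] [CharP k p] (r : Fin n →₀ ℕ) (hr : ∀ l, r l < p) (c : k)
    (z : HahnSeries (LexExponent n) k) :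
    ∃ (a : ℕ) (c' : k), hahnDiagonal (HahnSeries.single (exponentHom n r) c * z ^ p) =
      HahnSeries.single (a : ℤ) c' * hahnDiagonal z ^ p := by
  by_cases h : ∀ l, r l = r 0
  · refine ⟨r 0, c, ?_⟩
    have : exponentHom n r = diagExponent n (r 0) :=
      funext fun l => congrArg Nat.cast (h l)
    rw [this, hahnDiagonal_single_mul, hahnDiagonal_pow_char]
  -- For `r` not constant the diagonal vanishes: an exponent `p s + r` with equal entries would make
  -- the entries of `r` congruent modulo `p`, hence equal, as they are below `p`.
  · refine ⟨0, 0, ?_⟩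
    rw [HahnSeries.single_eq_zero, zero_mul]
    ext b
    rw [coeff_hahnDiagonal, HahnSeries.coeff_single_mul,
      HahnSeries.coeff_pow_char_of_forall_ne, mul_zero, HahnSeries.coeff_zero]
    intro s hs
    obtain ⟨l, hl⟩ := not_forall.1 h
    have h0 : (p : ℤ) * s 0 = b - r 0 :=
      (nsmul_eq_mul p (s 0)).symm.trans (congrFun hs 0)
    have h1 : (p : ℤ) * s l = b - r l :=
      (nsmul_eq_mul p (s l)).symm.trans (congrFun hs l)
    have h2 : (r l : ℤ) ≡ r 0 [ZMOD p] := by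
      refine (Int.modEq_iff_dvd).2 ⟨s l - s 0, ?_⟩
      linear_combination h0 - h1
    exact hl (Nat.ModEq.eq_of_lt_of_lt ((Int.natCast_modEq_iff).1 h2) (hr l) (hr 0))

end

/-! ### Cartier's formula. -/

theorem sum_range_mul_eq_sum_sum {A : Type*} [AddCommMonoid A] (g : ℕ → A) (p M : ℕ) :
    ∑ i ∈ Finset.range (p * M), g i =
      ∑ j ∈ Finset.range M, ∑ s ∈ Finset.range p, g (p * j + s) := by
  induction M with
  | zero => simp
  | succ M ih => rw [Nat.mul_succ, Finset.sum_range_add, ih, Finset.sum_range_succ]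

/-- Cartier's formula: if `f` is a root of `E`, then `P(f) E'(f)^(p-1)` is read off from the
coefficients of `P E^(p-1)` with exponents congruent to `-1` modulo `p`. -/
theorem eval_mul_derivative_pow_eq_sum {R : Type*} [CommRing R] (p : ℕ) [hp : Fact p.Prime]
    [CharP R p] {f : R} {E : R[X]} (hE : E.eval f = 0) (P : R[X]) {M : ℕ}
    (hM : (P * E ^ (p - 1)).natDegree < p * M) :
    P.eval f * E.derivative.eval f ^ (p - 1) =
      ∑ j ∈ Finset.range M, (P * E ^ (p - 1)).coeff (p * j + (p - 1)) * f ^ (p * j) := by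
  have hp0 := hp.out.pos
  -- With `E(y + f) = y F(y)`, the coefficient of `y^(p-1)` in the Taylor expansion of `P E^(p-1)`
  -- at `f` is `P(f) F(0)^(p-1)`. The same coefficient is a Hasse derivative at `f`, which Lucas'
  -- theorem evaluates.
  obtain ⟨F, hF⟩ : X ∣ taylor f E := by
    rw [X_dvd_iff, taylor_coeff_zero, hE]
  have hF0 : F.coeff 0 = E.derivative.eval f := by
    rw [← taylor_coeff_one, hF, coeff_X_mul]
  have h1 : (taylor f (P * E ^ (p - 1))).coeff (p - 1) =
      P.eval f * E.derivative.eval f ^ (p - 1) := by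
    rw [taylor_mul, taylor_pow, hF, mul_pow, mul_left_comm,
      coeff_X_pow_mul', if_pos le_rfl, Nat.sub_self,
      mul_coeff_zero, taylor_coeff_zero, coeff_zero_eq_eval_zero, eval_pow,
      ← coeff_zero_eq_eval_zero, hF0]
  rw [← h1, taylor_coeff]
  generalize P * E ^ (p - 1) = Q at hM ⊢
  have hchoose : ∀ j s, s < p → ((p * j + s).choose (p - 1) : R) = if s = p - 1 then 1 else 0 := by
    intro j s hs
    have h := Choose.choose_modEq_choose_mod_mul_choose_div_nat (n := p * j + s) (k := p - 1) (p := p)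
    rw [Nat.mul_add_mod, Nat.mod_eq_of_lt hs, Nat.mod_eq_of_lt (Nat.sub_lt hp0 one_pos),
      Nat.div_eq_of_lt (Nat.sub_lt hp0 one_pos), Nat.choose_zero_right, mul_one] at h
    rw [(CharP.natCast_eq_natCast R p).2 h]
    split_ifs with h'
    · rw [h', Nat.choose_self, Nat.cast_one]
    · rw [Nat.choose_eq_zero_of_lt (by lia), Nat.cast_zero]
  rw [hasseDeriv_apply, sum_over_range' _ _ _ hM, eval_finsetSum, sum_range_mul_eq_sum_sum]
  · refine Finset.sum_congr rfl fun j _ => ?_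
    rw [Finset.sum_eq_single (p - 1)]
    · rw [hchoose j _ (Nat.sub_lt hp0 one_pos), if_pos rfl, one_mul, eval_monomial,
        Nat.add_sub_cancel]
    · intro s hs hne
      rw [hchoose j s (Finset.mem_range.1 hs), if_neg hne, zero_mul, monomial_zero_right, eval_zero]
    · exact fun h => absurd (Finset.mem_range.2 (Nat.sub_lt hp0 one_pos)) h
  · intro i
    rw [mul_zero, monomial_zero_right]

/-! ### Section operators and separability. -/

/-- Over a field of characteristic `p`, there is an additive map that is inverse-Frobenius
semilinear and does not vanish at a given nonzero element. -/
theorem exists_inverse_frobenius_semilinear {k : Type*} [Field k] (p : ℕ) [Fact p.Prime]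
    [CharP k p] {b : k} (hb : b ≠ 0) :
    ∃ θ : k →+ k, (∀ x y, θ (x ^ p * y) = x * θ y) ∧ θ b ≠ 0 := by
  -- A linear form over the subfield of `p`-th powers, followed by the inverse of Frobenius on that
  -- subfield, replaces the `p`-th root, which need not exist in `k`.
  obtain ⟨φ, hφ⟩ := Module.Projective.exists_dual_ne_zero (frobenius k p).fieldRange hb
  let e := (frobenius k p).rangeRestrictFieldEquiv
  refine ⟨e.symm.toAddMonoidHom.comp φ.toAddMonoidHom, fun x y => ?_, fun h => ?_⟩
  · have h1 : x ^ p * y = e x • y := rfl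
    change e.symm (φ (x ^ p * y)) = x * e.symm (φ y)
    rw [h1, map_smul, smul_eq_mul, map_mul, e.symm_apply_apply]
  · exact hφ ((map_eq_zero_iff _ e.symm.injective).1 h)

/-- The section operator `∑ a(m) tᵐ ↦ ∑ θ(a(p m + r)) tᵐ`. -/
noncomputable def sectionOp {n : ℕ} {k : Type*} [Field k] (p : ℕ) (θ : k →+ k) (r : Fin n →₀ ℕ) :
    MvPowerSeries (Fin n) k →+ MvPowerSeries (Fin n) k where
  toFun v m := θ (MvPowerSeries.coeff (p • m + r) v)
  map_zero' := by
    ext m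
    exact map_zero θ
  map_add' u v := by
    ext m
    exact map_add θ _ _

theorem coeff_sectionOp {n : ℕ} {k : Type*} [Field k] (p : ℕ) (θ : k →+ k) (r : Fin n →₀ ℕ)
    (v : MvPowerSeries (Fin n) k) (m : Fin n →₀ ℕ) :
    MvPowerSeries.coeff m (sectionOp p θ r v) = θ (MvPowerSeries.coeff (p • m + r) v) := rfl

theorem sectionOp_pow_mul {n : ℕ} {k : Type*} [Field k] (p : ℕ) [hp : Fact p.Prime] [CharP k p]
    {θ : k →+ k} (hθ : ∀ x y, θ (x ^ p * y) = x * θ y) {r : Fin n →₀ ℕ} (hr : ∀ l, r l < p)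
    (u v : MvPowerSeries (Fin n) k) : sectionOp p θ r (u ^ p * v) = u * sectionOp p θ r v := by
  classical
  have hp0 := hp.out.ne_zero
  have hcoeff : ∀ m, MvPowerSeries.coeff (p • m) (u ^ p) = MvPowerSeries.coeff m u ^ p := by
    intro m
    rw [← MvPowerSeries.map_frobenius_expand p hp0, MvPowerSeries.coeff_map,
      MvPowerSeries.coeff_expand_smul, frobenius_def]
  ext m
  rw [coeff_sectionOp, MvPowerSeries.coeff_mul, MvPowerSeries.coeff_mul, map_sum]
  symm
  refine Finset.sum_of_injOn (fun x => (p • x.1, p • x.2 + r)) ?_ ?_ ?_ ?_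
  · intro x _ y _ h
    rw [Prod.mk.injEq, add_left_inj] at h
    exact Prod.ext (nsmul_right_injective hp0 h.1) (nsmul_right_injective hp0 h.2)
  · intro x hx
    rw [Finset.mem_coe, Finset.HasAntidiagonal.mem_antidiagonal] at hx ⊢
    rw [← hx, smul_add, add_assoc]
  · rintro ⟨a, b⟩ hab hnot
    rw [Finset.HasAntidiagonal.mem_antidiagonal] at hab
    -- If `a = p a'`, then `r l < p` forces `a' ≤ m`, so the pair is in the image. Otherwise `u ^ p`
    -- has no coefficient at `a`.
    by_cases ha : ∀ l, p ∣ a l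
    · choose a' ha' using ha
      refine absurd ⟨(Finsupp.equivFunOnFinite.symm a', m - Finsupp.equivFunOnFinite.symm a'),
        ?_, ?_⟩ hnot
      all_goals
        have hle : ∀ l, a' l ≤ m l := by
          intro l
          have h := DFunLike.congr_fun hab l
          simp only [Finsupp.add_apply, Finsupp.smul_apply, smul_eq_mul, ha'] at h
          have h2 := hr l
          by_contra! h3
          have h4 := Nat.mul_le_mul_left p (Nat.succ_le_of_lt h3)
          rw [Nat.mul_succ] at h4
          lia
      · rw [Finset.mem_coe, Finset.HasAntidiagonal.mem_antidiagonal]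
        ext l
        simpa using Nat.add_sub_cancel' (hle l)
      · have h1 : p • Finsupp.equivFunOnFinite.symm a' = a := by
          ext l
          simp [ha']
        refine Prod.ext h1 (add_left_cancel (a := a) ?_)
        rw [hab, ← h1, ← add_assoc, ← smul_add]
        congr 2
        ext l
        simpa using Nat.add_sub_cancel' (hle l)
    · obtain ⟨l, hl⟩ := not_forall.1 ha
      rw [← MvPowerSeries.map_frobenius_expand p hp0, MvPowerSeries.coeff_map,
        MvPowerSeries.coeff_expand_of_not_dvd p hp0 u hl, map_zero, zero_mul, map_zero]
  · intro x _
    rw [hcoeff, hθ, coeff_sectionOp]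

theorem exists_coe_eq_sectionOp {n : ℕ} {k : Type*} [Field k] {p : ℕ} (hp : p ≠ 0) (θ : k →+ k)
    (r : Fin n →₀ ℕ) (q : MvPolynomial (Fin n) k) :
    ∃ q' : MvPolynomial (Fin n) k, (q' : MvPowerSeries (Fin n) k) = sectionOp p θ r q := by
  classical
  induction q using MvPolynomial.induction_on' with
  | monomial i c =>
    by_cases h : ∃ m, p • m + r = i
    · obtain ⟨m, rfl⟩ := h
      refine ⟨MvPolynomial.monomial m (θ c), ?_⟩
      ext m'
      rw [MvPolynomial.coeff_coe, coeff_sectionOp, MvPolynomial.coeff_coe,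
        MvPolynomial.coeff_monomial, MvPolynomial.coeff_monomial]
      simp only [add_left_inj, (nsmul_right_injective hp).eq_iff]
      split_ifs <;> simp
    · refine ⟨0, ?_⟩
      ext m'
      rw [coeff_sectionOp, MvPolynomial.coeff_coe, MvPolynomial.coeff_coe,
        MvPolynomial.coeff_monomial, if_neg fun h' => h ⟨m', h'.symm⟩, map_zero,
        MvPolynomial.coeff_zero]
  | add q₁ q₂ h₁ h₂ =>
    obtain ⟨q₁', h₁⟩ := h₁
    obtain ⟨q₂', h₂⟩ := h₂
    exact ⟨q₁' + q₂', by rw [MvPolynomial.coe_add, MvPolynomial.coe_add, map_add, h₁, h₂]⟩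

/-- Algebraic power series are separable: the minimal polynomial has a simple root at `f`. -/
theorem IsMinimalPolynomial.aeval_derivative_ne_zero {n : ℕ} {k : Type*} [Field k] (p : ℕ)
    [hp : Fact p.Prime] [CharP k p] {f : MvPowerSeries (Fin n) k}
    {E : (MvPolynomial (Fin n) k)[X]} (hE : IsMinimalPolynomial f E) :
    aeval f (derivative E) ≠ 0 := by
  classical
  intro h0
  have hp0 := hp.out.ne_zero
  have hdeg : E.natDegree ≠ 0 := by
    intro hd
    have h := hE.2.1
    rw [eq_C_of_natDegree_eq_zero hd, aeval_C, MvPowerSeries.algebraMap_apply'] at h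
    apply hE.1
    rw [eq_C_of_natDegree_eq_zero hd, C_eq_zero]
    simpa using h
  have hder : derivative E = 0 := by
    by_contra hne
    exact (natDegree_le_of_dvd (hE.2.2 _ h0) hne).not_gt (natDegree_derivative_lt hdeg)
  -- Now `E(y) = G(y^p)`. A section operator takes `p`-th roots in `G(f^p) = 0` and yields a
  -- relation `Q(f) = 0` of degree at most `deg G < deg E`; `r` and `θ` are chosen so that one
  -- nonzero coefficient of `G` survives.
  set G := contract p E with hG
  have hGE : expand _ p G = E := expand_contract p hder hp0
  have hG0 : G ≠ 0 := by
    rintro h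
    rw [h, map_zero] at hGE
    exact hE.1 hGE.symm
  obtain ⟨j₀, hj₀⟩ : ∃ j, G.coeff j ≠ 0 := ⟨_, leadingCoeff_ne_zero.2 hG0⟩
  obtain ⟨i₀, hi₀⟩ := MvPolynomial.ne_zero_iff.1 hj₀
  obtain ⟨θ, hθ, hθ0⟩ := exists_inverse_frobenius_semilinear p hi₀
  set r : Fin n →₀ ℕ := i₀.mapRange (· % p) (Nat.zero_mod p) with hr
  set m : Fin n →₀ ℕ := i₀.mapRange (· / p) (Nat.zero_div p) with hm
  have hmr : p • m + r = i₀ := by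
    ext l
    simpa [hm, hr] using Nat.div_add_mod (i₀ l) p
  have hrp : ∀ l, r l < p := fun l => by simpa [hr] using Nat.mod_lt _ hp.out.pos
  choose S hS using exists_coe_eq_sectionOp (n := n) (k := k) hp0 θ r
  set Q : (MvPolynomial (Fin n) k)[X] :=
    ∑ j ∈ Finset.range (G.natDegree + 1), monomial j (S (G.coeff j)) with hQ
  have hQf : aeval f Q = 0 := by
    have h1 := hE.2.1
    rw [← hGE, expand_aeval, aeval_eq_sum_range] at h1
    have h2 := congrArg (sectionOp p θ r) h1
    rw [map_zero, map_sum] at h2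
    rw [hQ, map_sum, ← h2]
    refine Finset.sum_congr rfl fun j _ => ?_
    rw [aeval_monomial, Algebra.smul_def, MvPowerSeries.algebraMap_apply',
      MvPowerSeries.algebraMap_apply', ← pow_mul, mul_comm p j, pow_mul, mul_comm _ ((f ^ j) ^ p),
      sectionOp_pow_mul p hθ hrp]
    simp [hS, mul_comm]
  have hQ0 : Q ≠ 0 := by
    intro h
    have h1 := congrArg (fun q => q.coeff j₀) h
    simp only [hQ, finsetSum_coeff, coeff_monomial, coeff_zero] at h1
    rw [Finset.sum_ite_eq' (Finset.range _), if_pos (Finset.mem_range_succ_iff.2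
      (le_natDegree_of_ne_zero hj₀))] at h1
    have h2 := hS (G.coeff j₀)
    rw [h1] at h2
    have h3 := congrArg (MvPowerSeries.coeff m) h2
    rw [coeff_sectionOp, hmr, MvPolynomial.coeff_coe, MvPolynomial.coeff_coe,
      MvPolynomial.coeff_zero] at h3
    exact hθ0 h3.symm
  have hdG : E.natDegree = G.natDegree * p := by rw [← hGE, natDegree_expand]
  have hQd : Q.natDegree ≤ G.natDegree :=
    natDegree_sum_le_of_forall_le _ _ fun j hj =>
      (natDegree_monomial_le _).trans (Finset.mem_range_succ_iff.1 hj)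
  have h3 := (natDegree_le_of_dvd (hE.2.2 Q hQf) hQ0).trans hQd
  have h4 : G.natDegree ≠ 0 := fun h => hdeg (by rw [hdG, h, zero_mul])
  have := hp.out.two_le
  nlinarith [Nat.pos_of_ne_zero h4]

/-! ### Linearized polynomials from spans of `p`-th powers. -/

theorem pow_char_mem_span_range {K L ι : Type*} [Field K] [Field L] [Algebra K L] (p : ℕ)
    [Fact p.Prime] [CharP L p] {g : ι → L} {x : L} (hx : x ∈ Submodule.span K (Set.range g)) :
    x ^ p ∈ Submodule.span K (Set.range fun i => g i ^ p) := by
  induction hx using Submodule.span_induction with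
  | mem y hy =>
    obtain ⟨i, rfl⟩ := hy
    exact Submodule.subset_span ⟨i, rfl⟩
  | zero =>
    rw [zero_pow (Fact.out : p.Prime).ne_zero]
    exact zero_mem _
  | add y z _ _ hy hz =>
    rw [add_pow_char]
    exact add_mem hy hz
  | smul c y _ hy =>
    rw [_root_.smul_pow]
    exact Submodule.smul_mem _ _ hy

/-- If finitely many elements are linear combinations of their `p`-th powers, then every element
of their span is a root of a linearized polynomial of bounded `p`-degree. -/
theorem exists_isLinearized_of_mem_span {K L ι : Type*} [Field K] [Field L] [Algebra K L]
    [Fintype ι] (p : ℕ) [Fact p.Prime] [CharP L p] {g : ι → L}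
    (hg : ∀ i, g i ∈ Submodule.span K (Set.range fun i => g i ^ p)) {x : L}
    (hx : x ∈ Submodule.span K (Set.range g)) {N : ℕ} (hN : Fintype.card ι ≤ N) :
    ∃ (m : ℕ) (P : K[X]), m ≤ N ∧ IsLinearized p m P ∧ aeval x P = 0 := by
  classical
  let V : ℕ → Submodule K L := fun m => Submodule.span K (Set.range fun i => g i ^ p ^ m)
  have hstep : ∀ {m y}, y ∈ V m → y ^ p ∈ V (m + 1) := by
    intro m y hy
    have h := pow_char_mem_span_range p hy
    simp only [← pow_mul, ← pow_succ] at h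
    exact h
  have hgen : ∀ m i, g i ^ p ^ m ∈ V (m + 1) := by
    intro m
    induction m with
    | zero =>
      intro i
      simpa [V] using hg i
    | succ m ih =>
      intro i
      rw [pow_succ, pow_mul]
      exact hstep (ih i)
  have hmono : Monotone V := monotone_nat_of_le_succ fun m =>
    Submodule.span_le.2 (Set.range_subset_iff.2 (hgen m))
  have hxm : ∀ m, x ^ p ^ m ∈ V m := by
    intro m
    induction m with
    | zero => simpa [V] using hx
    | succ m ih =>
      rw [pow_succ, pow_mul]
      exact hstep ih
  have hfin : Module.Finite K (V N) := Module.Finite.span_of_finite K (Set.finite_range _)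
  -- These are `N + 1` vectors in a space of dimension at most `N`.
  let v : Fin (N + 1) → V N := fun m => ⟨x ^ p ^ (m : ℕ), hmono (Nat.lt_succ_iff.1 m.2) (hxm m)⟩
  have hdep : ¬LinearIndependent K v := by
    intro h
    have h1 := h.fintype_card_le_finrank
    have h2 : Module.finrank K (V N) ≤ Fintype.card ι := finrank_range_le_card _
    rw [Fintype.card_fin] at h1
    lia
  obtain ⟨c, hc, i, hi⟩ := Fintype.not_linearIndependent_iff.1 hdep
  let c' : ℕ → K := fun j => if h : j < N + 1 then c ⟨j, h⟩ else 0
  have hc' : ∀ j : Fin (N + 1), c' j = c j := fun j => dif_pos j.2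
  have hsum : ∑ j ∈ Finset.range (N + 1), c' j • x ^ p ^ j = 0 := by
    rw [Finset.sum_range]
    have h := congrArg Subtype.val hc
    rw [Submodule.coe_sum] at h
    simpa [hc', v] using h
  -- Truncation at the last nonzero coefficient makes the `p`-degree exactly `m`.
  set m := Nat.findGreatest (fun j => c' j ≠ 0) N with hm
  have hmN : m ≤ N := Nat.findGreatest_le N
  have hm0 : c' m ≠ 0 :=
    Nat.findGreatest_spec (P := fun j => c' j ≠ 0) (Nat.lt_succ_iff.1 i.2) (by rwa [hc'])
  refine ⟨m, _, hmN, ⟨c', hm0, rfl⟩, ?_⟩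
  rw [map_sum, ← hsum]
  simp only [map_mul, map_pow, aeval_C, aeval_X, ← Algebra.smul_def]
  refine Finset.sum_subset (Finset.range_mono (Nat.succ_le_succ hmN)) fun j hj hjm => ?_
  rw [Finset.mem_range] at hj hjm
  have := Nat.findGreatest_is_greatest (P := fun j => c' j ≠ 0) (n := N) (k := j) (by lia) (by lia)
  rw [not_not.1 this, zero_smul]

/-- A root of a linearized polynomial of `p`-degree `m ≤ N`, where `N > 0`, is algebraic of degree
at most `p ^ N - 1`. -/
theorem IsLinearized.natDegree_minpoly_le {K L : Type*} [Field K] [Field L] [Algebra K L]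
    {p m N : ℕ} (hp : p.Prime) {P : K[X]} (hP : IsLinearized p m P) {x : L}
    (hx : aeval x P = 0) (hmN : m ≤ N) (hN : 0 < N) :
    IsAlgebraic K x ∧ (minpoly K x).natDegree ≤ p ^ N - 1 := by
  obtain ⟨c, hc, rfl⟩ := hP
  have hpN : p ^ 1 ≤ p ^ N := Nat.pow_le_pow_right hp.pos hN
  have hp2 := hp.two_le
  -- The minimal polynomial of `0` has degree `1`, which is why `N > 0` is needed; for `x ≠ 0` a
  -- factor `X` can be cancelled.
  by_cases hx0 : x = 0
  · subst hx0
    refine ⟨isAlgebraic_zero, ?_⟩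
    rw [minpoly.zero, natDegree_X]
    lia
  set Q : K[X] := ∑ i ∈ Finset.range (m + 1), C (c i) * X ^ (p ^ i - 1) with hQ
  have hPQ : ∑ i ∈ Finset.range (m + 1), C (c i) * X ^ (p ^ i) = X * Q := by
    rw [hQ, Finset.mul_sum]
    refine Finset.sum_congr rfl fun i _ => ?_
    rw [mul_left_comm, ← pow_succ', Nat.sub_add_cancel (Nat.pow_pos hp.pos)]
  rw [hPQ, map_mul, aeval_X] at hx
  have hQx : aeval x Q = 0 := (mul_eq_zero.1 hx).resolve_left hx0
  have hQ0 : Q ≠ 0 := by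
    intro h
    have h1 := congrArg (fun q => q.coeff (p ^ m - 1)) h
    simp only [hQ, finsetSum_coeff, coeff_C_mul, coeff_X_pow, coeff_zero] at h1
    rw [Finset.sum_eq_single m] at h1
    · simp [hc] at h1
    · intro b _ hb
      rw [if_neg, mul_zero]
      intro h2
      have h3 : p ^ m = p ^ b := by
        have := Nat.pow_pos (n := m) hp.pos
        have := Nat.pow_pos (n := b) hp.pos
        lia
      exact hb (Nat.pow_right_injective hp2 h3).symm
    · simp
  refine ⟨⟨Q, hQ0, hQx⟩, (natDegree_le_of_dvd (minpoly.dvd K x hQx) hQ0).trans ?_⟩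
  refine natDegree_sum_le_of_forall_le _ _ fun i hi => (natDegree_C_mul_X_pow_le _ _).trans ?_
  exact Nat.sub_le_sub_right (Nat.pow_le_pow_right hp.pos
    ((Finset.mem_range_succ_iff.1 hi).trans hmN)) 1

/-! ### Counting exponent vectors with a zero entry. -/

/-- The exponent vectors bounded entrywise by `h`. -/
def box {n : ℕ} (h : Fin n → ℕ) : Finset (Fin n → ℕ) :=
  Fintype.piFinset fun l => Finset.range (h l + 1)

theorem mem_box {n : ℕ} {h i : Fin n → ℕ} : i ∈ box h ↔ ∀ l, i l ≤ h l := by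
  simp [box]

/-- The exponent vectors of total degree at most `h`. -/
def simplex (n h : ℕ) : Finset (Fin n → ℕ) :=
  {i ∈ box fun _ => h | ∑ l, i l ≤ h}

theorem mem_simplex {n h : ℕ} {i : Fin n → ℕ} : i ∈ simplex n h ↔ ∑ l, i l ≤ h := by
  rw [simplex, Finset.mem_filter, mem_box, and_iff_right_iff_imp]
  exact fun hi l => (Finset.single_le_sum (fun _ _ => Nat.zero_le _) (Finset.mem_univ l)).trans hi

/-- The vectors in `S` with some entry equal to zero. -/
def boundaryPart {n : ℕ} (S : Finset (Fin n → ℕ)) : Finset (Fin n → ℕ) :=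
  {i ∈ S | ∃ l, i l = 0}

theorem mem_boundaryPart {n : ℕ} {S : Finset (Fin n → ℕ)} {i : Fin n → ℕ} :
    i ∈ boundaryPart S ↔ i ∈ S ∧ ∃ l, i l = 0 := Finset.mem_filter

theorem card_boundaryPart_le {n : ℕ} {S : Finset (Fin n → ℕ)} {a b : ℕ} (ha : S.card = a)
    {T : Finset (Fin n → ℕ)} (hT : ∀ i ∈ T, i ∈ S ∧ ∀ l, i l ≠ 0) (hb : T.card = b) :
    (boundaryPart S).card ≤ a - b := by
  have h1 := Finset.card_filter_add_card_filter_not (s := S) fun i => ∃ l, i l = 0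
  have h2 : T.card ≤ (S.filter fun i => ¬∃ l, i l = 0).card := Finset.card_le_card fun i hi =>
    Finset.mem_filter.2 ⟨(hT i hi).1, fun ⟨l, hl⟩ => (hT i hi).2 l hl⟩
  rw [boundaryPart]
  lia

theorem card_boundaryPart_box_le {n : ℕ} (h : Fin n → ℕ) :
    (boundaryPart (box h)).card ≤ ∏ l, (h l + 1) - ∏ l, h l := by
  refine card_boundaryPart_le (T := Fintype.piFinset fun l => Finset.Icc 1 (h l)) ?_ ?_ ?_
  · simp [box, Fintype.card_piFinset]
  · intro i hi
    rw [Fintype.mem_piFinset] at hi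
    simp only [Finset.mem_Icc] at hi
    exact ⟨mem_box.2 fun l => (hi l).2, fun l => Nat.one_le_iff_ne_zero.1 (hi l).1⟩
  · simp [Fintype.card_piFinset]

theorem card_simplex (n h : ℕ) : (simplex n h).card = (n + h).choose n := by
  have hc := Finset.card_finsuppAntidiag_nat_eq_choose (s := (Finset.univ : Finset (Fin (n + 1)))) h
  rw [Finset.card_univ, Fintype.card_fin, Nat.add_right_comm, Nat.add_sub_cancel] at hc
  rw [Nat.choose_symm_add, ← hc]
  -- The slack `h - ∑ i` becomes an additional coordinate, turning the inequality into an equality.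
  refine Finset.card_nbij' (fun i => Finsupp.equivFunOnFinite.symm (Fin.cons (h - ∑ l, i l) i))
    (fun f l => f l.succ) ?_ ?_ ?_ ?_
  · intro i hi
    have hi' := mem_simplex.1 hi
    rw [Finset.mem_coe, Finset.mem_finsuppAntidiag]
    refine ⟨?_, Finset.subset_univ _⟩
    rw [Fin.sum_univ_succ]
    simpa using Nat.sub_add_cancel hi'
  · intro f hf
    rw [Finset.mem_coe, Finset.mem_finsuppAntidiag, Fin.sum_univ_succ] at hf
    exact mem_simplex.2 (by lia)
  · intro i _
    ext l
    simp
  · intro f hf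
    rw [Finset.mem_coe, Finset.mem_finsuppAntidiag, Fin.sum_univ_succ] at hf
    ext l
    refine Fin.cases ?_ (fun l => ?_) l
    · simp only [Finsupp.equivFunOnFinite_symm_apply_apply, Fin.cons_zero]
      lia
    · simp

theorem card_boundaryPart_simplex_le (n h : ℕ) :
    (boundaryPart (simplex n h)).card ≤ (n + h).choose n - h.choose n := by
  rcases lt_or_ge h n with hn | hn
  · rw [Nat.choose_eq_zero_of_lt hn]
    exact card_boundaryPart_le (card_simplex n h) (T := ∅) (by simp) rfl
  -- Adding `1` to each entry raises the total degree by `n`, so the vectors without zero entries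
  -- form a translate of the simplex of size `h - n`.
  · refine card_boundaryPart_le (card_simplex n h)
      (T := (simplex n (h - n)).map ⟨fun i l => i l + 1, fun i j hij => ?_⟩) ?_ ?_
    · ext l
      exact Nat.succ_injective (congrFun hij l)
    · intro i hi
      obtain ⟨j, hj, rfl⟩ := Finset.mem_map.1 hi
      refine ⟨mem_simplex.2 ?_, fun l => Nat.succ_ne_zero _⟩
      have := mem_simplex.1 hj
      change ∑ l, (j l + 1) ≤ h
      rw [Finset.sum_add_distrib, Fin.sum_const, smul_eq_mul, mul_one]
      lia
    · rw [Finset.card_map, card_simplex, Nat.add_sub_cancel' hn]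

theorem bound_pos {n : ℕ} (hn : 0 < n) (d h : ℕ) (hs : Fin n → ℕ) : 0 < bound d h hs := by
  refine Nat.mul_pos d.succ_pos (lt_min (Nat.sub_pos_of_lt ?_) (Nat.sub_pos_of_lt ?_))
  · have : Nonempty (Fin n) := ⟨⟨0, hn⟩⟩
    refine lt_of_le_of_ne (Finset.prod_le_prod' fun l _ => Nat.le_succ _) fun he => ?_
    have h1 := card_boundaryPart_box_le hs
    rw [he, Nat.sub_self, Nat.le_zero, Finset.card_eq_zero] at h1
    have h2 : (fun _ => 0 : Fin n → ℕ) ∈ boundaryPart (box hs) :=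
      mem_boundaryPart.2 ⟨mem_box.2 fun _ => Nat.zero_le _, ⟨0, hn⟩, rfl⟩
    rw [h1] at h2
    exact Finset.notMem_empty _ h2
  · obtain ⟨m, rfl⟩ := Nat.exists_eq_succ_of_ne_zero hn.ne'
    rw [Nat.succ_add, Nat.succ_eq_add_one, Nat.choose_succ_succ]
    have h1 : h.choose (m + 1) ≤ (m + h).choose (m + 1) :=
      Nat.choose_le_choose _ (Nat.le_add_left h m)
    have h2 : 0 < (m + h).choose m := Nat.choose_pos (Nat.le_add_right m h)
    lia

/-! ### Exponents of products and powers in `k[t][y]`. -/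

/-- All exponents of `t` occurring in `Q ∈ k[t][y]` lie in `W`. -/
def SupportedIn {n : ℕ} {k : Type*} [Field k] (W : Set (Fin n →₀ ℕ))
    (Q : (MvPolynomial (Fin n) k)[X]) : Prop :=
  ∀ j, ∀ i ∈ (Q.coeff j).support, i ∈ W

theorem SupportedIn.mul {n : ℕ} {k : Type*} [Field k] {W₁ W₂ W : Set (Fin n →₀ ℕ)}
    (hW : W₁ + W₂ ⊆ W) {Q₁ Q₂ : (MvPolynomial (Fin n) k)[X]} (h₁ : SupportedIn W₁ Q₁)
    (h₂ : SupportedIn W₂ Q₂) : SupportedIn W (Q₁ * Q₂) := by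
  classical
  intro j i hi
  rw [coeff_mul] at hi
  obtain ⟨x, -, hx⟩ := Finset.mem_biUnion.1 (MvPolynomial.support_sum hi)
  obtain ⟨a, ha, b, hb, rfl⟩ := Finset.mem_add.1 (MvPolynomial.support_mul _ _ hx)
  exact hW (Set.add_mem_add (h₁ _ a ha) (h₂ _ b hb))

theorem SupportedIn.pow {n : ℕ} {k : Type*} [Field k] {W : ℕ → Set (Fin n →₀ ℕ)}
    (hW0 : 0 ∈ W 0) (hW : ∀ a b, W a + W b ⊆ W (a + b)) {Q : (MvPolynomial (Fin n) k)[X]}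
    (h : SupportedIn (W 1) Q) (m : ℕ) : SupportedIn (W m) (Q ^ m) := by
  classical
  induction m with
  | zero =>
    intro j i hi
    rw [pow_zero, coeff_one] at hi
    split_ifs at hi
    · rw [← MvPolynomial.C_1] at hi
      rw [Finset.mem_singleton.1 (MvPolynomial.support_monomial_subset hi)]
      exact hW0
    · simp at hi
  | succ m ih =>
    rw [pow_succ]
    exact ih.mul (hW m 1) h

theorem supportedIn_monomial_mul_X_pow {n : ℕ} {k : Type*} [Field k] {W : Set (Fin n →₀ ℕ)}
    {i : Fin n →₀ ℕ} (hi : i ∈ W) (c : k) (j : ℕ) :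
    SupportedIn W (C (MvPolynomial.monomial i c) * X ^ j) := by
  classical
  intro l m hm
  rw [coeff_C_mul_X_pow] at hm
  split_ifs at hm
  · rwa [Finset.mem_singleton.1 (MvPolynomial.support_monomial_subset hm)]
  · simp at hm

theorem single_mul_mem_span {k : Type*} [Field k] (a : ℕ) (c : k) {s : Set (LaurentSeries k)}
    {x : LaurentSeries k} (hx : x ∈ s) :
    HahnSeries.single (a : ℤ) c * x ∈ Submodule.span (RatFunc k) s := by
  have h : HahnSeries.single (a : ℤ) c * x =
      (algebraMap k[X] (RatFunc k) (C c * X ^ a)) • x := by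
    rw [Algebra.smul_def, ← IsScalarTower.algebraMap_apply, Polynomial.algebraMap_hahnSeries_apply,
      Polynomial.coe_mul, Polynomial.coe_C, Polynomial.coe_pow, Polynomial.coe_X, map_mul,
      HahnSeries.ofPowerSeries_C, HahnSeries.ofPowerSeries_X_pow, HahnSeries.C_apply,
      HahnSeries.single_mul_single, zero_add, mul_one]
  rw [h]
  exact Submodule.smul_mem _ _ (Submodule.subset_span hx)

/-! ### Diagonals of the quotients `tⁱ fʲ / E_y(t, f)`. -/

noncomputable section

theorem toHahn_algebraMap {n : ℕ} {k : Type*} [Field k] (q : MvPolynomial (Fin n) k) :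
    toHahn n k (algebraMap (MvPolynomial (Fin n) k) (MvPowerSeries (Fin n) k) q) =
      ∑ i ∈ q.support, HahnSeries.single (exponentHom n i) (q.coeff i) := by
  conv_lhs => rw [q.as_sum]
  rw [map_sum, map_sum]
  refine Finset.sum_congr rfl fun i _ => ?_
  rw [MvPowerSeries.algebraMap_apply', ← toHahn_monomial]
  congr 1
  simp

/-- The diagonal of `tⁱ yʲ / E_y(t, y)` at `y = f`. -/
def diagonalQuotient {n : ℕ} [NeZero n] {k : Type*} [Field k] (f : MvPowerSeries (Fin n) k)
    (E : (MvPolynomial (Fin n) k)[X]) (i : Fin n →₀ ℕ) (j : ℕ) : LaurentSeries k :=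
  hahnDiagonal (HahnSeries.single (exponentHom n i) 1 *
    (toHahn n k f ^ j / toHahn n k (aeval f (derivative E))))

/-- The largest power of `t₁⋯tₙ` dividing `tⁱ` is taken out; its exponent is the least entry of `i`.
-/
theorem exists_hahnDiagonal_single_mul_eq {n : ℕ} [NeZero n] {k : Type*} [Field k]
    (i : Fin n →₀ ℕ) :
    ∃ (a : ℕ) (i₀ : Fin n →₀ ℕ), i₀ ≤ i ∧ (∃ l, i₀ l = 0) ∧
      ∀ (c : k) (x : HahnSeries (LexExponent n) k),
        hahnDiagonal (HahnSeries.single (exponentHom n i) c * x) = HahnSeries.single (a : ℤ) c *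
          hahnDiagonal (HahnSeries.single (exponentHom n i₀) 1 * x) := by
  obtain ⟨l, hl⟩ := Finite.exists_min i
  refine ⟨i l, i - Finsupp.equivFunOnFinite.symm fun _ => i l, tsub_le_self, ⟨l, by simp⟩,
    fun c x => ?_⟩
  rw [← hahnDiagonal_single_mul, ← mul_assoc, HahnSeries.single_mul_single, mul_one]
  have h : exponentHom n i = diagExponent n (i l) +
      exponentHom n (i - Finsupp.equivFunOnFinite.symm fun _ => i l) := by
    funext m
    have h : (i m : ℤ) = i l + ((i m - i l : ℕ) : ℤ) := by
      have := hl m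
      lia
    exact h
  rw [← h]

theorem exists_hahnDiagonal_single_mul_eq_diagonalQuotient {n : ℕ} [NeZero n] {k : Type*} [Field k]
    (f : MvPowerSeries (Fin n) k) (E : (MvPolynomial (Fin n) k)[X]) (i : Fin n →₀ ℕ) :
    ∃ (a : ℕ) (i₀ : Fin n →₀ ℕ), i₀ ≤ i ∧ (∃ l, i₀ l = 0) ∧
      ∀ (c : k) (j : ℕ), hahnDiagonal (HahnSeries.single (exponentHom n i) c *
        (toHahn n k f ^ j / toHahn n k (aeval f (derivative E)))) =
          HahnSeries.single (a : ℤ) c * diagonalQuotient f E i₀ j := by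
  obtain ⟨a, i₀, h1, h2, h3⟩ := exists_hahnDiagonal_single_mul_eq (k := k) i
  exact ⟨a, i₀, h1, h2, fun c j => h3 c _⟩

/-- Every quotient `P(t, f) / E_y(t, f)` with `deg_y P ≤ deg_y E` is a combination of `p`-th powers
of quotients `tⁱ fʲ / E_y(t, f)`, with coefficients read off from `P E^(p-1)`. -/
theorem toHahn_aeval_div_eq_sum {n : ℕ} {k : Type*} [Field k] (p : ℕ) [hp : Fact p.Prime]
    [CharP k p] {f : MvPowerSeries (Fin n) k} {E P : (MvPolynomial (Fin n) k)[X]}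
    (hE : aeval f E = 0) (hD : aeval f (derivative E) ≠ 0) (hP : P.natDegree ≤ E.natDegree) :
    toHahn n k (aeval f P) / toHahn n k (aeval f (derivative E)) =
      ∑ j ∈ Finset.range (E.natDegree + 1),
        ∑ m ∈ ((P * E ^ (p - 1)).coeff (p * j + (p - 1))).support,
          HahnSeries.single (exponentHom n (m.mapRange (· % p) (Nat.zero_mod p)))
            (((P * E ^ (p - 1)).coeff (p * j + (p - 1))).coeff m) *
          (HahnSeries.single (exponentHom n (m.mapRange (· / p) (Nat.zero_div p))) 1 *
            (toHahn n k f ^ j / toHahn n k (aeval f (derivative E)))) ^ p := by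
  have hp1 : p - 1 + 1 = p := Nat.sub_add_cancel hp.out.one_le
  set D := toHahn n k (aeval f (derivative E)) with hDdef
  have hD0 : D ≠ 0 := (map_ne_zero_iff _ (toHahn_injective n k)).2 hD
  have : CharP (MvPowerSeries (Fin n) k) p :=
    charP_of_injective_ringHom (f := (MvPowerSeries.C : k →+* MvPowerSeries (Fin n) k))
      MvPowerSeries.C_injective p
  let α := algebraMap (MvPolynomial (Fin n) k) (MvPowerSeries (Fin n) k)
  have hdeg : (P * E ^ (p - 1)).natDegree < p * (E.natDegree + 1) := by
    have h1 : (P * E ^ (p - 1)).natDegree ≤ E.natDegree + (p - 1) * E.natDegree :=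
      natDegree_mul_le_of_le hP natDegree_pow_le
    have h2 : E.natDegree + (p - 1) * E.natDegree = p * E.natDegree := by
      rw [add_comm, ← Nat.succ_mul, Nat.succ_eq_add_one, hp1]
    rw [Nat.mul_succ]
    have := hp.out.pos
    lia
  have hmap : (P * E ^ (p - 1)).map α = P.map α * E.map α ^ (p - 1) := by
    rw [Polynomial.map_mul, Polynomial.map_pow]
  have key := eval_mul_derivative_pow_eq_sum p (f := f) (E := E.map α)
    (by rw [eval_map_algebraMap, hE]) (P.map α)
    (M := E.natDegree + 1) (by rw [← hmap]; exact (natDegree_map_le).trans_lt hdeg)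
  rw [← hmap, derivative_map, eval_map_algebraMap, eval_map_algebraMap] at key
  have key2 := congrArg (toHahn n k) key
  rw [map_mul, map_pow, map_sum, ← hDdef] at key2
  -- Expanding the fraction by `D ^ (p - 1)` produces the numerator of Cartier's formula and turns
  -- the denominator into the `p`-th power `D ^ p`.
  rw [← mul_div_mul_right _ _ (pow_ne_zero (p - 1) hD0), key2, ← pow_succ', hp1, Finset.sum_div]
  refine Finset.sum_congr rfl fun j _ => ?_
  rw [coeff_map, map_mul, toHahn_algebraMap, Finset.sum_mul, Finset.sum_div]
  refine Finset.sum_congr rfl fun m _ => ?_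
  have hm : exponentHom n (m.mapRange (· % p) (Nat.zero_mod p)) +
      p • exponentHom n (m.mapRange (· / p) (Nat.zero_div p)) = exponentHom n m := by
    rw [← map_nsmul, ← map_add]
    congr 1
    ext l
    simpa using Nat.mod_add_div (m l) p
  rw [mul_pow, HahnSeries.single_pow, ← mul_assoc, HahnSeries.single_mul_single, hm, one_pow,
    mul_one, div_pow, ← pow_mul, mul_comm j p, map_pow, mul_div_assoc]

/-- A set of exponent vectors, graded by multiplicities, that controls the exponents of the
sections of `P E^(p-1)`. -/
structure IsExponentFiltration {n : ℕ} (W : ℕ → Set (Fin n →₀ ℕ)) : Prop where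
  zero_mem : 0 ∈ W 0
  add_subset : ∀ a b, W a + W b ⊆ W (a + b)
  mem_of_nsmul_le : ∀ (p : ℕ) (_ : 0 < p) (i j : Fin n →₀ ℕ), i ∈ W p → p • j ≤ i → j ∈ W 1

/-- If all exponents of `E` lie in `W 1`, the diagonal of `f` has a linearized polynomial whose
`p`-degree is bounded by the number of elements of `W 1` with some zero entry. -/
theorem exists_isLinearized_diagonal {n : ℕ} [NeZero n] {k : Type*} [Field k] (p : ℕ)
    [hp : Fact p.Prime] [CharP k p] {f : MvPowerSeries (Fin n) k}
    {E : (MvPolynomial (Fin n) k)[X]} (hE : IsMinimalPolynomial f E)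
    {W : ℕ → Set (Fin n →₀ ℕ)} (hW : IsExponentFiltration W) (hEW : SupportedIn (W 1) E)
    {T : Finset (Fin n → ℕ)} (hT : ∀ i : Fin n →₀ ℕ, ⇑i ∈ T ↔ i ∈ W 1 ∧ ∃ l, i l = 0) {N : ℕ}
    (hN : (E.natDegree + 1) * T.card ≤ N) :
    ∃ (m : ℕ) (P : (RatFunc k)[X]), m ≤ N ∧ IsLinearized p m P ∧
      aeval (diagonal f : LaurentSeries k) P = 0 := by
  have hD := hE.aeval_derivative_ne_zero p
  set D := toHahn n k (aeval f (derivative E)) with hDdef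
  have hD0 : D ≠ 0 := (map_ne_zero_iff _ (toHahn_injective n k)).2 hD
  have hp0 := hp.out.pos
  let g : Fin (E.natDegree + 1) × T → LaurentSeries k := fun x =>
    diagonalQuotient f E (Finsupp.equivFunOnFinite.symm x.2) x.1
  -- The case `p = 1` of the filtration axiom says that `W 1` is closed downwards.
  have hlow : ∀ {i j : Fin n →₀ ℕ}, i ∈ W 1 → j ≤ i → j ∈ W 1 := fun {i j} hi hj =>
    hW.mem_of_nsmul_le 1 one_pos i j hi (by rwa [one_smul])
  have hmem : ∀ i ∈ W 1, ∃ a : ℕ, ∀ j < E.natDegree + 1, ∃ x, ∀ c,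
      hahnDiagonal (HahnSeries.single (exponentHom n i) c * (toHahn n k f ^ j / D)) =
        HahnSeries.single (a : ℤ) c * g x := by
    intro i hi
    obtain ⟨a, i₀, hle, hz, h⟩ := exists_hahnDiagonal_single_mul_eq_diagonalQuotient f E i
    exact ⟨a, fun j hj => ⟨(⟨j, hj⟩, ⟨i₀, (hT _).2 ⟨hlow hi hle, hz⟩⟩), fun c => h c j⟩⟩
  refine exists_isLinearized_of_mem_span (g := g) p ?_ ?_ (by simpa using hN)
  · rintro ⟨j, i⟩
    set i' : Fin n →₀ ℕ := Finsupp.equivFunOnFinite.symm i with hi'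
    have hiW : i' ∈ W 1 := ((hT i').1 i.2).1
    set P : (MvPolynomial (Fin n) k)[X] := C (MvPolynomial.monomial i' 1) * X ^ (j : ℕ) with hP
    have hPd : P.natDegree ≤ E.natDegree :=
      (natDegree_C_mul_X_pow_le _ _).trans (Nat.lt_succ_iff.1 j.2)
    have hPf : toHahn n k (aeval f P) / D =
        HahnSeries.single (exponentHom n i') 1 * (toHahn n k f ^ (j : ℕ) / D) := by
      rw [hP, map_mul, map_pow, aeval_C, aeval_X, map_mul, map_pow,
        MvPowerSeries.algebraMap_apply', ← toHahn_monomial, mul_div_assoc]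
      simp
    have hg : g (j, i) = hahnDiagonal (toHahn n k (aeval f P) / D) := by
      rw [hPf]
      rfl
    have hsupp : SupportedIn (W p) (P * E ^ (p - 1)) :=
      SupportedIn.mul
        (by simpa only [Nat.add_sub_cancel' hp.out.one_le] using hW.add_subset 1 (p - 1))
        (supportedIn_monomial_mul_X_pow hiW 1 j)
        (hEW.pow hW.zero_mem hW.add_subset (p - 1))
    rw [hg, toHahn_aeval_div_eq_sum p hE.2.1 hD hPd, map_sum]
    refine sum_mem fun l hl => ?_
    rw [map_sum]
    refine sum_mem fun m hm => ?_
    obtain ⟨b, c', hb⟩ := exists_hahnDiagonal_single_mul_pow p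
      (m.mapRange (· % p) (Nat.zero_mod p)) (fun _ => Nat.mod_lt _ hp0)
      (((P * E ^ (p - 1)).coeff (p * l + (p - 1))).coeff m)
      (HahnSeries.single (exponentHom n (m.mapRange (· / p) (Nat.zero_div p))) 1 *
        (toHahn n k f ^ l / D))
    -- Closure of the system: exponents of `P E^(p-1)` lie in `W p`, so their quotients by `p` lie
    -- in `W 1`.
    have hmW : m.mapRange (· / p) (Nat.zero_div p) ∈ W 1 :=
      hW.mem_of_nsmul_le p hp0 m _ (hsupp _ m hm) fun _ => Nat.mul_div_le _ _
    obtain ⟨a, ha⟩ := hmem _ hmW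
    obtain ⟨x, hx⟩ := ha l (Finset.mem_range.1 hl)
    rw [hb, hx, mul_pow, HahnSeries.single_pow, ← mul_assoc, HahnSeries.single_mul_single,
      nsmul_eq_mul, ← Nat.cast_mul, ← Nat.cast_add]
    exact single_mul_mem_span _ _ ⟨x, rfl⟩
  -- Since `f = f E_y / E_y`, the numerator `y E_y` is used. Its coefficients are integer multiples
  -- of those of `E`, so no new `t`-exponents occur, and its degree can reach `d`, hence the factor
  -- `d + 1`.
  · set Q : (MvPolynomial (Fin n) k)[X] := X * derivative E with hQ
    have hQd : Q.natDegree < E.natDegree + 1 := by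
      by_cases h : E.natDegree = 0
      · rw [hQ, derivative_of_natDegree_zero h, mul_zero, natDegree_zero]
        exact Nat.succ_pos _
      · refine (natDegree_mul_le.trans (Nat.add_le_add natDegree_X_le le_rfl)).trans_lt ?_
        have := natDegree_derivative_lt h
        lia
    have hQW : SupportedIn (W 1) Q := by
      intro l m hm
      cases l with
      | zero => simp [hQ] at hm
      | succ l =>
        rw [hQ, coeff_X_mul, coeff_derivative] at hm
        refine hEW (l + 1) m (MvPolynomial.mem_support_iff.2 fun h => ?_)
        rw [← Nat.cast_succ, ← map_natCast (MvPolynomial.C (σ := Fin n) (R := k)), mul_comm,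
          MvPolynomial.mem_support_iff, MvPolynomial.coeff_C_mul, h, mul_zero] at hm
        exact hm rfl
    have hf : toHahn n k f = toHahn n k (aeval f Q) / D := by
      rw [hQ, map_mul, aeval_X, map_mul, mul_div_cancel_right₀ _ hD0]
    rw [← hahnDiagonal_toHahn, hf, aeval_eq_sum_range' hQd, map_sum, Finset.sum_div, map_sum]
    refine sum_mem fun l hl => ?_
    rw [Algebra.smul_def, map_mul, map_pow, toHahn_algebraMap, mul_div_assoc, Finset.sum_mul,
      map_sum]
    refine sum_mem fun m hm => ?_
    obtain ⟨a, ha⟩ := hmem m (hQW l m hm)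
    obtain ⟨x, hx⟩ := ha l (Finset.mem_range.1 hl)
    rw [hx]
    exact single_mul_mem_span _ _ ⟨x, rfl⟩

/-! ### The two exponent regions, given by partial and total height, and the theorem. -/

theorem isExponentFiltration_box {n : ℕ} (h : Fin n → ℕ) :
    IsExponentFiltration fun c => {i : Fin n →₀ ℕ | ∀ l, i l ≤ c * h l} where
  zero_mem _ := Nat.zero_le _
  add_subset := by
    rintro a b _ ⟨i, hi, j, hj, rfl⟩ l
    exact (Nat.add_le_add (hi l) (hj l)).trans_eq (Nat.add_mul _ _ _).symm
  mem_of_nsmul_le p hp i j hi hj l := by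
    rw [one_mul]
    exact Nat.le_of_mul_le_mul_left ((hj l).trans (hi l)) hp

theorem isExponentFiltration_simplex (n h : ℕ) :
    IsExponentFiltration fun c => {i : Fin n →₀ ℕ | ∑ l, i l ≤ c * h} where
  zero_mem := by simp
  add_subset := by
    rintro a b _ ⟨i, hi, j, hj, rfl⟩
    refine (Finset.sum_add_distrib (f := i) (g := j) (s := Finset.univ)).trans_le ?_
    exact (Nat.add_le_add hi hj).trans_eq (Nat.add_mul _ _ _).symm
  mem_of_nsmul_le p hp i j hi hj := by
    have h1 : p * ∑ l, j l ≤ ∑ l, i l := by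
      rw [Finset.mul_sum]
      exact Finset.sum_le_sum fun l _ => hj l
    have h2 : p * ∑ l, j l ≤ p * h := h1.trans hi
    exact (Nat.le_of_mul_le_mul_left h2 hp).trans_eq (one_mul h).symm

theorem le_partialHeight {n : ℕ} {k : Type*} [Field k] (f : MvPowerSeries (Fin n) k) (j : ℕ)
    {i : Fin n →₀ ℕ} (hi : i ∈ ((minimalPolynomial f).coeff j).support) (l : Fin n) :
    i l ≤ partialHeight f l := by
  classical
  have hj : j ∈ (minimalPolynomial f).support := by
    rw [Polynomial.mem_support_iff]
    rintro h
    simp [h] at hi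
  refine le_trans ?_ (Finset.le_sup (f := fun j => ((minimalPolynomial f).coeff j).degreeOf l) hj)
  exact MvPolynomial.monomial_le_degreeOf l hi

theorem sum_le_totalHeight {n : ℕ} {k : Type*} [Field k] (f : MvPowerSeries (Fin n) k) (j : ℕ)
    {i : Fin n →₀ ℕ} (hi : i ∈ ((minimalPolynomial f).coeff j).support) :
    ∑ l, i l ≤ totalHeight f := by
  have hj : j ∈ (minimalPolynomial f).support := by
    rw [Polynomial.mem_support_iff]
    rintro h
    simp [h] at hi
  refine le_trans ?_ (Finset.le_sup (f := fun j => ((minimalPolynomial f).coeff j).totalDegree) hj)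
  have h := MvPolynomial.le_totalDegree hi
  rwa [Finsupp.sum_fintype _ _ fun _ => rfl] at h

end

end AlgSeries

theorem theorem3p1 {n : ℕ} (hn : 0 < n) {k : Type*} [Field k] (p : ℕ) [Fact p.Prime] [CharP k p]
    (f : MvPowerSeries (Fin n) k) (hf : IsAlgebraic (MvPolynomial (Fin n) k) f)
    (N : ℕ)
    (hN : N = AlgSeries.bound (AlgSeries.degree f) (AlgSeries.totalHeight f)
      (AlgSeries.partialHeight f)) :
    (∃ (m : ℕ) (P : Polynomial (RatFunc k)), m ≤ N ∧ AlgSeries.IsLinearized p m P ∧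
      Polynomial.aeval (AlgSeries.diagonal f : LaurentSeries k) P = 0) ∧
    (IsAlgebraic (RatFunc k) (AlgSeries.diagonal f : LaurentSeries k) ∧
      (minpoly (RatFunc k) (AlgSeries.diagonal f : LaurentSeries k)).natDegree ≤ p ^ N - 1) := by
  have : NeZero n := ⟨hn.ne'⟩
  have hE := AlgSeries.isMinimalPolynomial_minimalPolynomial hf
  have key : ∃ (m : ℕ) (P : Polynomial (RatFunc k)), m ≤ N ∧ AlgSeries.IsLinearized p m P ∧
      Polynomial.aeval (AlgSeries.diagonal f : LaurentSeries k) P = 0 := by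
    rw [hN, AlgSeries.bound, AlgSeries.degree]
    rcases min_choice ((∏ i, (AlgSeries.partialHeight f i + 1)) - ∏ i, AlgSeries.partialHeight f i)
      ((n + AlgSeries.totalHeight f).choose n - (AlgSeries.totalHeight f).choose n) with h | h
    · rw [h]
      refine AlgSeries.exists_isLinearized_diagonal p hE
        (AlgSeries.isExponentFiltration_box (AlgSeries.partialHeight f))
        (T := AlgSeries.boundaryPart (AlgSeries.box (AlgSeries.partialHeight f))) ?_ ?_
        (Nat.mul_le_mul_left _ (AlgSeries.card_boundaryPart_box_le _))
      · intro j i hi l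
        rw [one_mul]
        exact AlgSeries.le_partialHeight f j hi l
      · intro i
        rw [AlgSeries.mem_boundaryPart, AlgSeries.mem_box]
        simp
    · rw [h]
      refine AlgSeries.exists_isLinearized_diagonal p hE
        (AlgSeries.isExponentFiltration_simplex n (AlgSeries.totalHeight f))
        (T := AlgSeries.boundaryPart (AlgSeries.simplex n (AlgSeries.totalHeight f))) ?_ ?_
        (Nat.mul_le_mul_left _ (AlgSeries.card_boundaryPart_simplex_le _ _))
      · intro j i hi
        rw [Set.mem_ofPred_eq, one_mul]
        exact AlgSeries.sum_le_totalHeight f j hi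
      · intro i
        rw [AlgSeries.mem_boundaryPart, AlgSeries.mem_simplex]
        simp
  refine ⟨key, ?_⟩
  obtain ⟨m, P, hm, hP, hx⟩ := key
  exact hP.natDegree_minpoly_le Fact.out hx hm (hN ▸ AlgSeries.bound_pos hn _ _ _)
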